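/- For points $p,q,x\in\mathbb{R}^n$ the (noise-free) comparison of $x$ with the pair $(p,q)$ is $\operatorname{sign}(\|x-q\|^2-\|x-p\|^2)$, i.e. $+1$ if $x$ is closer to $p$ and $-1$ if $x$ is closer to $q$. A point $y$ is called consistent with a family of pairs if its comparisons with these pairs all agree with those of $x$. Let $n\ge 1$, $0<\varepsilon_t<R$, $\eta>0$, and let $x\in\mathbb{R}^n$ with $\|x\|\le R$. Put $t=\lceil\log_2(R/\varepsilon_t)\rceil\ge 1$ and $R_\ell=R\,2^{1-\ell}$ for $\ell=1,\dots,t$. Consider the following adaptive scheme with $t$ stages, started at $\widehat x^0=0$. In stage $\ell$, conditionally on everything that happened before, $m_\ell$ pairs $(p_i,q_i)$ are drawn with all $p_i,q_i$ independent with law $\mathcal{N}\big(\widehat x^{\ell-1},\tfrac{2R_\ell^2}{n}I\big)$, and $x$ is compared with these pairs; the estimate $\widehat x^{\ell}$ is then any (measurably chosen) point consistent with the pairs of stage $\ell$ (this is required only as long as $\|x-\widehat x^{\ell-1}\|\le R_\ell$, i.e. as long as the localization has not already failed). The numbers $m_\ell$ satisfy $m_\ell\ge\lfloor m/t\rfloor$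 for every $\ell$, and $\sum_\ell m_\ell\le m$. There is a universal constant $C>0$ such that, for all such $n,R,\varepsilon_t,\eta,x$, and every run of the scheme as above, if the total number of comparisons $m$ satisfies $$m\ \ge\ 2C\,\log_2\!\Big(\frac{2R}{\varepsilon_t}\Big)\Big(n\log(2\sqrt n)+\log\frac1\eta\Big),$$ then with probability at least $1-\log_2(2R/\varepsilon_t)\,\eta$, every $\widehat x\in\mathbb{R}^n$ that is consistent with the pairs of the last stage (in particular, every $\widehat x$ that is consistent with all pairs of all stages) satisfies $\|x-\widehat x\|\le\varepsilon_t$. -/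

import Mathlib

open MeasureTheory ProbabilityTheory

noncomputable section

/-- The comparison of `x` with the pair of items `pq = (p, q)`:
`sign (‖x - q‖² - ‖x - p‖²)`, i.e. `+1` if `x` is closer to `p` and `-1` if `x` is closer to `q`. -/
def comparison {n : ℕ} (pq : EuclideanSpace ℝ (Fin n) × EuclideanSpace ℝ (Fin n))
    (x : EuclideanSpace ℝ (Fin n)) : SignType :=
  SignType.sign (‖x - pq.2‖ ^ 2 - ‖x - pq.1‖ ^ 2)

/-- The vector `𝒜(x)` of all comparisons of `x` with `k` pairs of items. -/
def comparisons {n k : ℕ}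
    (pq : Fin k → EuclideanSpace ℝ (Fin n) × EuclideanSpace ℝ (Fin n))
    (x : EuclideanSpace ℝ (Fin n)) : Fin k → SignType :=
  fun i => comparison (pq i) x

/-- The law of one item for centre `c` and radius `r`: the Gaussian `𝒩(c, (2 r² / n) I)` on `ℝⁿ`. -/
def itemLaw (n : ℕ) (c : EuclideanSpace ℝ (Fin n)) (r : ℝ) : Measure (EuclideanSpace ℝ (Fin n)) :=
  multivariateGaussian c ((2 * r ^ 2 / (n : ℝ)) • (1 : Matrix (Fin n) (Fin n) ℝ))

/-- The law of `k` independent pairs `(p, q)` of independent items with law `itemLaw n c r`. -/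
def stageLaw (n k : ℕ) (c : EuclideanSpace ℝ (Fin n)) (r : ℝ) :
    Measure (Fin k → EuclideanSpace ℝ (Fin n) × EuclideanSpace ℝ (Fin n)) :=
  Measure.pi fun _ => (itemLaw n c r).prod (itemLaw n c r)

/-- The radius of the stage with index `ℓ` (stages are indexed `0, 1, …, t - 1`): it starts at `R`
and is halved from one stage to the next. -/
def stageRadius (R : ℝ) (ℓ : ℕ) : ℝ := R / 2 ^ ℓ

/-- A run of the adaptive scheme with `t` stages for localizing the point `x` of the ball of
radius `R` about `0`, on the probability space `(Ω, μ)`. Stage `ℓ < t` uses `N ℓ` noise-free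
comparisons of `x`; `est ℓ` is the centre used in stage `ℓ`, and `est (ℓ + 1)` is the estimate
produced by stage `ℓ`. -/
structure AdaptiveScheme {n : ℕ} {Ω : Type*} [mΩ : MeasurableSpace Ω] (μ : Measure Ω)
    (x : EuclideanSpace ℝ (Fin n)) (R : ℝ) (t : ℕ) (N : ℕ → ℕ) where
  /-- `hist ℓ` is the information available before the items of stage `ℓ` are drawn. -/
  hist : Filtration ℕ mΩ
  /-- `items ℓ` are the pairs `(p, q)` of stage `ℓ`. -/
  items : (ℓ : ℕ) → Ω → Fin (N ℓ) → EuclideanSpace ℝ (Fin n) × EuclideanSpace ℝ (Fin n)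
  /-- The successive centres and estimates. -/
  est : ℕ → Ω → EuclideanSpace ℝ (Fin n)
  est_zero : ∀ ω, est 0 ω = 0
  measurable_items : ∀ ℓ < t, Measurable[hist (ℓ + 1)] (items ℓ)
  measurable_est : ∀ ℓ ≤ t, Measurable[hist ℓ] (est ℓ)
  /-- Conditionally on `hist ℓ`, the items of stage `ℓ` are independent with law
  `𝒩(est ℓ, (2 R_ℓ² / n) I)`, where `R_ℓ = stageRadius R ℓ`. -/
  cond_law : ∀ ℓ < t, ∀ A : Set Ω, MeasurableSet[hist ℓ] A →
    ∀ B : Set (Fin (N ℓ) → EuclideanSpace ℝ (Fin n) × EuclideanSpace ℝ (Fin n)),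
      MeasurableSet B →
        μ (A ∩ items ℓ ⁻¹' B) = ∫⁻ ω in A, stageLaw n (N ℓ) (est ℓ ω) (stageRadius R ℓ) B ∂μ
  /-- The estimate of stage `ℓ` is consistent with the comparisons of that stage. Nothing is
  required once the localization has failed, that is, once `x` is outside the current ball (that
  ball may then contain no consistent point). -/
  consistent : ∀ ℓ < t, ∀ᵐ ω ∂μ, ‖x - est ℓ ω‖ ≤ stageRadius R ℓ →
    comparisons (items ℓ ω) (est (ℓ + 1) ω) = comparisons (items ℓ ω) x

end

/-! One stage halves the radius. Let `‖x - c‖ ≤ r` and put `ρ = r / √n`. A rotation by `π / 4`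
writes a pair as `p - q = 2ρa`, `p + q = 2c + 2ρb` with `a`, `b` independent standard Gaussians, so
the bisector has normal `a` and, given `a`, a Gaussian offset. It therefore separates `x` from a
fixed point at distance `r / 2`, with margin `r / (64 √n)`, with probability at least the absolute
constant `separationProb` (`stdGaussian_prod_separating`, `le_itemLaw_prod_separatingPairs`).

Take a net of the sphere of radius `r / 2` about `x` whose mesh is that margin; `(65 n) ^ n` points
suffice. By a union bound, `k` pairs cut off the whole sphere except with probability `(65 n) ^ n *
(1 - separationProb) ^ k`. The consistent points are star-shaped about `x`, so nothing beyond the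
sphere is consistent either (`exists_stage_failure_set`).

The net depends on `x` and `r` but not on `c`, so one failure set serves every random centre and the
conditional law applies to it (`AdaptiveScheme.measure_failure_le`). A union bound over the stages
finishes the proof. -/

open scoped RealInnerProductSpace ENNReal

/-! ### One-dimensional Gaussian estimates -/

/-- An interval inside `[-K, K]` has standard Gaussian measure at least its length times the value
of the density at `K`. -/
lemma ofReal_le_gaussianReal_Ioo {K α β : ℝ} (hα : -K ≤ α) (hβ : β ≤ K) :
    ENNReal.ofReal (gaussianPDFReal 0 1 K * (β - α)) ≤ gaussianReal 0 1 (Set.Ioo α β) := by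
  rw [gaussianReal_apply 0 one_ne_zero, ENNReal.ofReal_mul (gaussianPDFReal_nonneg _ _ _),
    ← Real.volume_Ioo, ← setLIntegral_const]
  refine setLIntegral_mono' measurableSet_Ioo fun z hz => ENNReal.ofReal_le_ofReal ?_
  simp only [gaussianPDFReal]
  gcongr ?_ * Real.exp (-?_ / ?_)
  rw [sub_zero, sub_zero]
  exact sq_le_sq' (by linarith [hz.1]) (by linarith [hz.2])

/-- The standard Gaussian density is at most `1 / 2`. -/
lemma gaussianPDFReal_zero_one_le (z : ℝ) : gaussianPDFReal 0 1 z ≤ 1 / 2 := by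
  have hpi : (2 : ℝ) ≤ √(2 * Real.pi * ((1 : NNReal) : ℝ)) :=
    Real.le_sqrt_of_sq_le (by norm_num; linarith [Real.pi_gt_three])
  rw [gaussianPDFReal]
  calc (√(2 * Real.pi * ((1 : NNReal) : ℝ)))⁻¹ * Real.exp _
      ≤ 2⁻¹ * 1 := by
        gcongr
        rw [Real.exp_le_one_iff, neg_div]
        have : 0 ≤ (z - 0) ^ 2 / (2 * ((1 : NNReal) : ℝ)) := by positivity
        linarith
    _ = 1 / 2 := by norm_num

lemma gaussianReal_Ioo_le (d : ℝ) : gaussianReal 0 1 (Set.Ioo (-d) d) ≤ ENNReal.ofReal d := by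
  rw [gaussianReal_apply 0 one_ne_zero]
  calc ∫⁻ z in Set.Ioo (-d) d, gaussianPDF 0 1 z
      ≤ ∫⁻ _ in Set.Ioo (-d) d, ENNReal.ofReal (1 / 2) :=
        lintegral_mono fun z => ENNReal.ofReal_le_ofReal (gaussianPDFReal_zero_one_le z)
    _ = ENNReal.ofReal d := by
        rw [setLIntegral_const, Real.volume_Ioo, ← ENNReal.ofReal_mul (by norm_num)]
        congr 1; ring

lemma inner_sq_div_norm_sq_le {E : Type*} [NormedAddCommGroup E] [InnerProductSpace ℝ E] (x u : E) : ⟪x, u⟫ ^ 2 / ‖u‖ ^ 2 ≤ ‖x‖ ^ 2 := by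
  refine div_le_of_le_mul₀ (by positivity) (by positivity) ?_
  rw [← mul_pow, sq_le_sq, abs_of_nonneg (a := ‖x‖ * ‖u‖) (by positivity)]
  exact abs_real_inner_le_norm x u

/-! ### Norm and direction of a standard Gaussian vector -/

section

variable {E : Type*} [NormedAddCommGroup E] [InnerProductSpace ℝ E] [FiniteDimensional ℝ E]
  [MeasurableSpace E] [BorelSpace E]

lemma stdGaussian_map_inner (w : E) :
    (stdGaussian E).map (fun v => ⟪w, v⟫) = gaussianReal 0 (‖w‖ ^ 2).toNNReal := by
  have h := IsGaussian.map_eq_gaussianReal (μ := stdGaussian E) (innerSL ℝ w)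
  rw [integral_strongDual_stdGaussian, variance_dual_stdGaussian, innerSL_apply_norm] at h
  exact h

lemma stdGaussian_map_inner_div_norm {w : E} (hw : w ≠ 0) :
    (stdGaussian E).map (fun v => ⟪w, v⟫ / ‖w‖) = gaussianReal 0 1 := by
  have hw' : ‖w‖ ≠ 0 := norm_ne_zero_iff.2 hw
  have h := stdGaussian_map_inner (‖w‖⁻¹ • w)
  rw [norm_smul, norm_inv, norm_norm, inv_mul_cancel₀ hw'] at h
  simpa [inner_smul_left, div_eq_inv_mul] using h

lemma integral_inner_sq_stdGaussian (w : E) :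
    ∫ u, ⟪w, u⟫ ^ 2 ∂stdGaussian E = ‖w‖ ^ 2 := by
  have h := variance_dual_stdGaussian (innerSL ℝ w)
  rw [variance_of_integral_eq_zero (by fun_prop) (integral_strongDual_stdGaussian _),
    innerSL_apply_norm] at h
  exact h

lemma integral_norm_sq_stdGaussian :
    ∫ u, ‖u‖ ^ 2 ∂stdGaussian E = Module.finrank ℝ E := by
  simp_rw [← (stdOrthonormalBasis ℝ E).sum_sq_inner_right]
  rw [integral_finsetSum]
  · simp [integral_inner_sq_stdGaussian]
  · intro i _
    exact (IsGaussian.memLp_dual (stdGaussian E) (innerSL ℝ (stdOrthonormalBasis ℝ E i)) 2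
      (by simp)).integrable_sq

/-- The law of the direction of a standard Gaussian vector depends on the test vector only through
its norm. -/
lemma integral_inner_sq_div_norm_sq_congr {x y : E} (h : ‖x‖ = ‖y‖) :
    ∫ u, ⟪x, u⟫ ^ 2 / ‖u‖ ^ 2 ∂stdGaussian E = ∫ u, ⟪y, u⟫ ^ 2 / ‖u‖ ^ 2 ∂stdGaussian E := by
  set ρ := (ℝ ∙ (x - y))ᗮ.reflection with hρ
  have hxy : ρ x = y := Submodule.reflection_sub h
  conv_rhs => rw [← stdGaussian_map ρ]
  rw [integral_map (by fun_prop) (Measurable.aestronglyMeasurable (by fun_prop))]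
  simp_rw [← hxy, LinearIsometryEquiv.inner_map_map, LinearIsometryEquiv.norm_map]

lemma integrable_inner_sq_div_norm_sq (x : E) :
    Integrable (fun u => ⟪x, u⟫ ^ 2 / ‖u‖ ^ 2) (stdGaussian E) := by
  refine Integrable.of_bound (Measurable.aestronglyMeasurable (by fun_prop)) (‖x‖ ^ 2)
    (.of_forall fun u => ?_)
  rw [Real.norm_of_nonneg (by positivity)]
  exact inner_sq_div_norm_sq_le x u

/-- By rotation invariance `x` may be replaced by `‖x‖ • b i` for each vector of an orthonormal
basis; the squares then sum to `‖x‖ ^ 2`. Only an inequality is claimed since `‖u‖ ^ 2 / ‖u‖ ^ 2` is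
`0` at `u = 0`. -/
lemma integral_inner_sq_div_norm_sq_le (x : E) :
    Module.finrank ℝ E * ∫ u, ⟪x, u⟫ ^ 2 / ‖u‖ ^ 2 ∂stdGaussian E ≤ ‖x‖ ^ 2 := by
  set b := stdOrthonormalBasis ℝ E
  have h (i) : ∫ u, ⟪x, u⟫ ^ 2 / ‖u‖ ^ 2 ∂stdGaussian E =
      ∫ u, ⟪‖x‖ • b i, u⟫ ^ 2 / ‖u‖ ^ 2 ∂stdGaussian E :=
    integral_inner_sq_div_norm_sq_congr (by simp [norm_smul])
  calc Module.finrank ℝ E * ∫ u, ⟪x, u⟫ ^ 2 / ‖u‖ ^ 2 ∂stdGaussian E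
      = ∑ i, ∫ u, ⟪‖x‖ • b i, u⟫ ^ 2 / ‖u‖ ^ 2 ∂stdGaussian E := by
        simp [← h]
    _ = ∫ u, ‖x‖ ^ 2 * (‖u‖ ^ 2 / ‖u‖ ^ 2) ∂stdGaussian E := by
        rw [← integral_finsetSum _ fun i _ => integrable_inner_sq_div_norm_sq _]
        refine integral_congr_ae (.of_forall fun u => ?_)
        simp only [real_inner_smul_left, mul_pow]
        rw [← Finset.sum_div, ← Finset.mul_sum, b.sum_sq_inner_right, mul_div_assoc]
    _ ≤ ∫ _, ‖x‖ ^ 2 ∂stdGaussian E := by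
        refine integral_mono_of_nonneg (.of_forall fun u => ?_) (integrable_const _)
          (.of_forall fun u => ?_)
        · positivity
        · exact mul_le_of_le_one_right (by positivity) (div_self_le_one _)
    _ = ‖x‖ ^ 2 := by simp

/-- Markov's inequality for the norm of a standard Gaussian vector. -/
lemma stdGaussian_real_norm_ge_le (hE : 0 < Module.finrank ℝ E) :
    (stdGaussian E).real {u | 2 * √(Module.finrank ℝ E) ≤ ‖u‖} ≤ 1 / 4 := by
  set d : ℝ := (Module.finrank ℝ E : ℝ) with hd
  have hd0 : 0 < d := Nat.cast_pos.2 hE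
  have h := mul_meas_ge_le_integral_of_nonneg (μ := stdGaussian E) (f := fun u => ‖u‖ ^ 2)
    (.of_forall fun u => by positivity) (IsGaussian.memLp_two_id.integrable_norm_pow (by simp))
    (4 * d)
  rw [integral_norm_sq_stdGaussian] at h
  have hs : {u : E | 2 * √d ≤ ‖u‖} ⊆ {u | 4 * d ≤ ‖u‖ ^ 2} := fun u hu => by
    have := pow_le_pow_left₀ (by positivity) (Set.mem_ofPred.1 hu) 2
    rw [mul_pow, Real.sq_sqrt hd0.le] at this
    simpa using by linarith
  have := measureReal_mono (μ := stdGaussian E) hs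
  rw [← hd] at h
  nlinarith

/-- Chebyshev's inequality for the direction of a standard Gaussian vector. -/
lemma stdGaussian_real_inner_ge_le (hE : 0 < Module.finrank ℝ E) (x : E) :
    (stdGaussian E).real {u | 4 * ‖u‖ < √(Module.finrank ℝ E) * |⟪u, x⟫|} ≤ ‖x‖ ^ 2 / 16 := by
  set d : ℝ := (Module.finrank ℝ E : ℝ) with hd
  have hd0 : 0 < d := Nat.cast_pos.2 hE
  have h := mul_meas_ge_le_integral_of_nonneg (μ := stdGaussian E)
    (f := fun u => ⟪x, u⟫ ^ 2 / ‖u‖ ^ 2) (.of_forall fun u => by positivity)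
    (integrable_inner_sq_div_norm_sq x) (16 / d)
  have h' := integral_inner_sq_div_norm_sq_le x
  rw [← hd] at h'
  have hs : {u : E | 4 * ‖u‖ < √d * |⟪u, x⟫|} ⊆ {u | 16 / d ≤ ⟪x, u⟫ ^ 2 / ‖u‖ ^ 2} :=
    fun u hu => by
      have hu0 : 0 < ‖u‖ := by
        rw [norm_pos_iff]
        rintro rfl
        simp at hu
      have := pow_le_pow_left₀ (by positivity) (Set.mem_ofPred.1 hu).le 2
      rw [mul_pow, mul_pow, Real.sq_sqrt hd0.le, sq_abs, real_inner_comm] at this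
      simp only [Set.mem_ofPred_eq]
      rw [div_le_div_iff₀ hd0 (by positivity)]
      linarith
  have h3 := measureReal_mono (μ := stdGaussian E) hs
  have h4 := mul_le_mul_of_nonneg_left h hd0.le
  rw [← mul_assoc, mul_div_cancel₀ _ hd0.ne'] at h4
  linarith

lemma stdGaussian_real_abs_inner_lt_le {w : E} (hw : ‖w‖ = 1 / 2) :
    (stdGaussian E).real {u | |⟪u, w⟫| < 1 / 8} ≤ 1 / 4 := by
  have hw0 : w ≠ 0 := by rw [← norm_ne_zero_iff, hw]; norm_num
  have h : {u : E | |⟪u, w⟫| < 1 / 8} =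
      (fun v => ⟪w, v⟫ / ‖w‖) ⁻¹' Set.Ioo (-(1 / 4)) (1 / 4) := by
    ext u
    rw [Set.mem_ofPred, Set.mem_preimage, Set.mem_Ioo, ← abs_lt, hw, abs_div, real_inner_comm,
      div_lt_iff₀ (by norm_num)]
    norm_num
  rw [h, ← map_measureReal_apply (by fun_prop) measurableSet_Ioo,
    stdGaussian_map_inner_div_norm hw0]
  exact ENNReal.toReal_le_of_le_ofReal (by norm_num) (gaussianReal_Ioo_le _)

end

/-! ### Geometry of a comparison -/

section

variable {E : Type*} [NormedAddCommGroup E] [InnerProductSpace ℝ E]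

/-- The function whose sign is the comparison of `z` with the pair `pq`. -/
def comparisonGap (pq : E × E) (z : E) : ℝ := ‖z - pq.2‖ ^ 2 - ‖z - pq.1‖ ^ 2

/-- The pairs whose bisecting hyperplane separates `x` from `y`, with margin `δ` on both sides. -/
def separatingPairs (x y : E) (δ : ℝ) : Set (E × E) :=
  {pq | (2 * δ * ‖pq.1 - pq.2‖ < comparisonGap pq x ∧
      comparisonGap pq y < -(2 * δ * ‖pq.1 - pq.2‖)) ∨
    (2 * δ * ‖pq.1 - pq.2‖ < comparisonGap pq y ∧
      comparisonGap pq x < -(2 * δ * ‖pq.1 - pq.2‖))}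

lemma measurableSet_separatingPairs {E : Type*} [NormedAddCommGroup E] [MeasurableSpace E] [BorelSpace E]
    [SecondCountableTopology E] (x y : E) (δ : ℝ) : MeasurableSet (separatingPairs x y δ) := by
  unfold separatingPairs comparisonGap
  simp only [Set.ofPred_or, Set.ofPred_and]
  refine .union (.inter ?_ ?_) (.inter ?_ ?_) <;>
  exact measurableSet_lt (by fun_prop) (by fun_prop)

/-- The terms quadratic in the point cancel, so the gap is affine. Both the stability under small
displacements and the behaviour along segments rest on this. -/
lemma comparisonGap_sub (pq : E × E) (y z : E) :
    comparisonGap pq z - comparisonGap pq y = 2 * ⟪pq.1 - pq.2, z - y⟫ := by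
  simp only [comparisonGap, norm_sub_sq_real, inner_sub_left, inner_sub_right,
    real_inner_comm pq.1, real_inner_comm pq.2]
  ring

lemma abs_comparisonGap_sub_le (pq : E × E) (y z : E) :
    |comparisonGap pq z - comparisonGap pq y| ≤ 2 * ‖z - y‖ * ‖pq.1 - pq.2‖ := by
  rw [comparisonGap_sub, abs_mul, abs_two]
  linarith [abs_real_inner_le_norm (pq.1 - pq.2) (z - y)]

/-- If the bisecting hyperplane of a pair separates `x` from `y` with margin `δ`, then it separates
`x` from all points within distance `δ` of `y`. -/
lemma sign_comparisonGap_ne {x y z : E} {δ : ℝ} (hδ : 0 ≤ δ) {pq : E × E}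
    (h : pq ∈ separatingPairs x y δ) (hz : ‖z - y‖ ≤ δ) :
    SignType.sign (comparisonGap pq z) ≠ SignType.sign (comparisonGap pq x) := by
  have h1 := abs_le.1 ((abs_comparisonGap_sub_le pq y z).trans
    (by gcongr : 2 * ‖z - y‖ * ‖pq.1 - pq.2‖ ≤ 2 * δ * ‖pq.1 - pq.2‖))
  have h2 : 0 ≤ 2 * δ * ‖pq.1 - pq.2‖ := by positivity
  rcases h with ⟨hx, hy⟩ | ⟨hy, hx⟩
  · rw [sign_pos (by linarith : 0 < comparisonGap pq x),
      sign_neg (by linarith : comparisonGap pq z < 0)]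
    decide
  · rw [sign_neg (by linarith : comparisonGap pq x < 0),
      sign_pos (by linarith : 0 < comparisonGap pq z)]
    decide

/-- The comparison with a pair agrees along a segment if it agrees at the end points. -/
lemma sign_comparisonGap_add_smul {pq : E × E} {x y : E}
    (h : SignType.sign (comparisonGap pq y) = SignType.sign (comparisonGap pq x)) {s : ℝ}
    (hs0 : 0 ≤ s) (hs1 : s ≤ 1) :
    SignType.sign (comparisonGap pq (x + s • (y - x))) = SignType.sign (comparisonGap pq x) := by
  have h1 : comparisonGap pq (x + s • (y - x)) =
      (1 - s) * comparisonGap pq x + s * comparisonGap pq y := by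
    have h2 := comparisonGap_sub pq x (x + s • (y - x))
    have h3 := comparisonGap_sub pq x y
    rw [add_sub_cancel_left, inner_smul_right] at h2
    linear_combination h2 - s * h3
  rw [h1]
  rcases lt_trichotomy (comparisonGap pq x) 0 with hx | hx | hx
  · rw [sign_neg hx] at h ⊢
    rw [sign_eq_neg_one_iff] at h ⊢
    rcases hs0.eq_or_lt with rfl | hs
    · simpa using hx
    · nlinarith [mul_neg_of_pos_of_neg hs h, mul_nonpos_of_nonpos_of_nonneg hx.le (sub_nonneg.2 hs1)]
  · rw [hx, sign_zero, sign_eq_zero_iff] at h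
    simp [hx, h]
  · rw [sign_pos hx] at h ⊢
    rw [sign_eq_one_iff] at h ⊢
    rcases hs0.eq_or_lt with rfl | hs
    · simpa using hx
    · nlinarith [mul_pos hs h, mul_nonneg hx.le (sub_nonneg.2 hs1)]

/-- The comparison gap of the pair `(c + ρ (a + b), c + ρ (b - a))`. -/
lemma comparisonGap_add_smul (c a b z : E) (ρ : ℝ) :
    comparisonGap (c + ρ • (a + b), c + ρ • (b - a)) z =
      4 * ρ * (⟪a, z - c⟫ - ρ * ⟪a, b⟫) := by
  have h1 : z - (c + ρ • (b - a)) = (z - c - ρ • b) + ρ • a := by module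
  have h2 : z - (c + ρ • (a + b)) = (z - c - ρ • b) - ρ • a := by module
  simp only [comparisonGap]
  rw [h1, h2, norm_add_sq_real, norm_sub_sq_real (z - c - ρ • b), inner_smul_right,
    inner_sub_left (z - c), real_inner_smul_left, real_inner_comm a (z - c), real_inner_comm a b]
  ring

end

/-! ### Separation by a standard Gaussian pair -/

/-- A lower bound on the probability that a random pair separates two given points. -/
noncomputable def separationProb : ℝ := gaussianPDFReal 0 1 4 / 128

lemma separationProb_pos : 0 < separationProb :=
  div_pos (gaussianPDFReal_pos _ _ _ one_ne_zero) (by norm_num)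

lemma separationProb_le_one : separationProb ≤ 1 := by
  have := gaussianPDFReal_zero_one_le 4
  rw [separationProb]
  linarith

section

variable {E : Type*} [NormedAddCommGroup E] [InnerProductSpace ℝ E] [FiniteDimensional ℝ E]
  [MeasurableSpace E] [BorelSpace E]

/-- The standard Gaussian directions in which the projections of `x` and `y` are of typical size,
and typically far apart. -/
def typicalDirections (x y : E) : Set E :=
  {a | a ≠ 0 ∧ √(Module.finrank ℝ E) * |⟪a, x⟫| ≤ 4 * ‖a‖ ∧
    √(Module.finrank ℝ E) * |⟪a, y⟫| ≤ 4 * ‖a‖ ∧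
    ‖a‖ / 16 ≤ √(Module.finrank ℝ E) * |⟪a, x - y⟫|}

/-- Union bound over four bad events, of probability at most `1/16`, `(3/2)^2/16`, `1/4` and `1/4`,
which sum to less than `3/4`. The last two together give the gap: `‖a‖ < 2√d` and `1/8 ≤ |⟪a, x -
y⟫|`. -/
lemma stdGaussian_typicalDirections (hE : 0 < Module.finrank ℝ E) {x y : E} (hx : ‖x‖ ≤ 1)
    (hxy : ‖x - y‖ = 1 / 2) :
    1 / 4 ≤ (stdGaussian E).real (typicalDirections x y) := by
  set d : ℝ := (Module.finrank ℝ E : ℝ) with hd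
  have hd0 : 0 < d := Nat.cast_pos.2 hE
  have hy : ‖y‖ ≤ 3 / 2 := by
    have : ‖y‖ ≤ ‖x‖ + ‖x - y‖ := by
      simpa using norm_sub_le x (x - y)
    linarith
  have hsub : (typicalDirections x y)ᶜ ⊆ {a | 4 * ‖a‖ < √d * |⟪a, x⟫|} ∪
      {a | 4 * ‖a‖ < √d * |⟪a, y⟫|} ∪ {a | 2 * √d ≤ ‖a‖} ∪ {a | |⟪a, x - y⟫| < 1 / 8} := by
    intro a ha
    by_contra hcon
    simp only [Set.mem_union, Set.mem_ofPred_eq, not_or, not_lt, not_le] at hcon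
    obtain ⟨⟨⟨h1, h2⟩, h3⟩, h4⟩ := hcon
    refine ha ⟨?_, h1, h2, ?_⟩
    · rintro rfl
      norm_num at h4
    · have := mul_le_mul_of_nonneg_left h4 (Real.sqrt_nonneg d)
      linarith
  have h := (measureReal_mono (μ := stdGaussian E) hsub).trans
    ((measureReal_union_le _ _).trans (add_le_add_left ((measureReal_union_le _ _).trans
      (add_le_add_left (measureReal_union_le _ _) _)) _))
  have h1 := stdGaussian_real_inner_ge_le hE x
  have h2 := stdGaussian_real_inner_ge_le hE y
  have h3 := stdGaussian_real_norm_ge_le hE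
  have h4 := stdGaussian_real_abs_inner_lt_le hxy
  have hx2 := pow_le_pow_left₀ (norm_nonneg _) hx 2
  have hy2 := pow_le_pow_left₀ (norm_nonneg _) hy 2
  have hone : 1 ≤ (stdGaussian E).real (typicalDirections x y) +
      (stdGaussian E).real (typicalDirections x y)ᶜ := by
    have := measureReal_union_le (μ := stdGaussian E) (typicalDirections x y)
      (typicalDirections x y)ᶜ
    simpa using this
  rw [← hd] at h1 h2 h3
  linarith

/-- For a typical direction `a`, the level `⟪a, b⟫` falls strictly between the levels of `x` and `y`
with probability bounded below. -/
lemma stdGaussian_separating_level {x y a : E} (ha : a ∈ typicalDirections x y)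
    (h : ⟪a, x⟫ ≤ ⟪a, y⟫) :
    ENNReal.ofReal (gaussianPDFReal 0 1 4 / 32) ≤ stdGaussian E
      {b | √(Module.finrank ℝ E) * ⟪a, x⟫ - ⟪a, b⟫ < -(‖a‖ / 64) ∧
        ‖a‖ / 64 < √(Module.finrank ℝ E) * ⟪a, y⟫ - ⟪a, b⟫} := by
  obtain ⟨ha0, hx, hy, hxy⟩ := ha
  set s := √(Module.finrank ℝ E : ℝ)
  have hs : 0 ≤ s := Real.sqrt_nonneg _
  have hn : 0 < ‖a‖ := norm_pos_iff.2 ha0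
  have hset : {b | s * ⟪a, x⟫ - ⟪a, b⟫ < -(‖a‖ / 64) ∧ ‖a‖ / 64 < s * ⟪a, y⟫ - ⟪a, b⟫} =
      (fun b => ⟪a, b⟫ / ‖a‖) ⁻¹'
        Set.Ioo (s * ⟪a, x⟫ / ‖a‖ + 1 / 64) (s * ⟪a, y⟫ / ‖a‖ - 1 / 64) := by
    ext b
    rw [Set.mem_ofPred, Set.mem_preimage, Set.mem_Ioo, div_add' _ _ _ hn.ne',
      div_sub' hn.ne', div_lt_div_iff_of_pos_right hn, div_lt_div_iff_of_pos_right hn]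
    constructor <;> rintro ⟨h1, h2⟩ <;> constructor <;> linarith
  rw [hset, ← Measure.map_apply (by fun_prop) measurableSet_Ioo,
    stdGaussian_map_inner_div_norm ha0]
  have hx' : |s * ⟪a, x⟫ / ‖a‖| ≤ 4 := by
    rwa [abs_div, abs_mul, abs_of_nonneg hs, abs_norm, div_le_iff₀ hn]
  have hy' : |s * ⟪a, y⟫ / ‖a‖| ≤ 4 := by
    rwa [abs_div, abs_mul, abs_of_nonneg hs, abs_norm, div_le_iff₀ hn]
  have hlen : 1 / 16 ≤ s * ⟪a, y⟫ / ‖a‖ - s * ⟪a, x⟫ / ‖a‖ := by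
    rw [inner_sub_right, abs_of_nonpos (by linarith)] at hxy
    rw [← sub_div, le_div_iff₀ hn]
    linarith
  -- Removing the margin `1/64` at both ends leaves length at least `1/16 - 2/64 = 1/32` inside
  -- `[-4, 4]`.
  refine le_trans (ENNReal.ofReal_le_ofReal ?_)
    (ofReal_le_gaussianReal_Ioo (K := 4) (by linarith [(abs_le.1 hx').1])
      (by linarith [(abs_le.1 hy').2]))
  rw [div_eq_mul_one_div]
  exact mul_le_mul_of_nonneg_left (by linarith) (gaussianPDFReal_nonneg _ _ _)

/-- Integrate over `a` first: typical directions have mass at least `1/4`, and for each of them the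
level `⟪a, b⟫` separates with probability at least `gaussianPDFReal 0 1 4 / 32`. -/
lemma stdGaussian_prod_separating (hE : 0 < Module.finrank ℝ E) {x y : E} (hx : ‖x‖ ≤ 1)
    (hxy : ‖x - y‖ = 1 / 2) :
    ENNReal.ofReal separationProb ≤ (stdGaussian E).prod (stdGaussian E)
      {ab | (‖ab.1‖ / 64 < √(Module.finrank ℝ E) * ⟪ab.1, x⟫ - ⟪ab.1, ab.2⟫ ∧
          √(Module.finrank ℝ E) * ⟪ab.1, y⟫ - ⟪ab.1, ab.2⟫ < -(‖ab.1‖ / 64)) ∨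
        (‖ab.1‖ / 64 < √(Module.finrank ℝ E) * ⟪ab.1, y⟫ - ⟪ab.1, ab.2⟫ ∧
          √(Module.finrank ℝ E) * ⟪ab.1, x⟫ - ⟪ab.1, ab.2⟫ < -(‖ab.1‖ / 64))} := by
  rw [Measure.prod_apply]
  swap
  · simp only [Set.ofPred_or, Set.ofPred_and]
    refine .union (.inter ?_ ?_) (.inter ?_ ?_) <;>
    exact measurableSet_lt (by fun_prop) (by fun_prop)
  have htyp : MeasurableSet (typicalDirections x y) := by
    simp only [typicalDirections, Set.ofPred_and]
    refine .inter (measurableSet_singleton 0).compl (.inter ?_ (.inter ?_ ?_)) <;>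
    exact measurableSet_le (by fun_prop) (by fun_prop)
  calc ENNReal.ofReal separationProb
      = ENNReal.ofReal (gaussianPDFReal 0 1 4 / 32) * ENNReal.ofReal (1 / 4) := by
        rw [← ENNReal.ofReal_mul (div_nonneg (gaussianPDFReal_nonneg _ _ _) (by norm_num)),
          separationProb]
        congr 1; ring
    _ ≤ ENNReal.ofReal (gaussianPDFReal 0 1 4 / 32) * stdGaussian E (typicalDirections x y) := by
        gcongr
        exact ENNReal.ofReal_le_of_le_toReal (stdGaussian_typicalDirections hE hx hxy)
    _ = ∫⁻ _ in typicalDirections x y, ENNReal.ofReal (gaussianPDFReal 0 1 4 / 32)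
          ∂stdGaussian E := (setLIntegral_const _ _).symm
    _ ≤ ∫⁻ a in typicalDirections x y, _ ∂stdGaussian E := by
        refine setLIntegral_mono' htyp fun a ha => ?_
        rcases le_total ⟪a, x⟫ ⟪a, y⟫ with h | h
        · exact (stdGaussian_separating_level ha h).trans
            (measure_mono fun b hb => Or.inr ⟨hb.2, hb.1⟩)
        · have ha' : a ∈ typicalDirections y x :=
            ⟨ha.1, ha.2.2.1, ha.2.1, by rw [← neg_sub, inner_neg_right, abs_neg]; exact ha.2.2.2⟩
          exact (stdGaussian_separating_level ha' h).trans
            (measure_mono fun b hb => Or.inl ⟨hb.2, hb.1⟩)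
    _ ≤ _ := setLIntegral_le_lintegral _ _

end

/-! ### From standard Gaussians to the law of the items -/

open scoped MatrixOrder in
lemma itemLaw_eq_map_stdGaussian (n : ℕ) (c : EuclideanSpace ℝ (Fin n)) {r : ℝ} (hr : 0 ≤ r) :
    itemLaw n c r = (stdGaussian (EuclideanSpace ℝ (Fin n))).map
      (fun u => c + (√2 * (r / √n)) • u) := by
  have hs : CFC.sqrt ((2 * r ^ 2 / (n : ℝ)) • (1 : Matrix (Fin n) (Fin n) ℝ)) =
      (√2 * (r / √n)) • (1 : Matrix (Fin n) (Fin n) ℝ) := by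
    have hone : (0 : Matrix (Fin n) (Fin n) ℝ) ≤ 1 := Matrix.PosSemidef.one.nonneg
    refine CFC.sqrt_unique ?_ (smul_nonneg (by positivity) hone)
    rw [smul_mul_smul_comm, mul_one]
    congr 1
    rw [mul_mul_mul_comm, Real.mul_self_sqrt (by norm_num), div_mul_div_comm,
      Real.mul_self_sqrt (by positivity)]
    ring
  rw [itemLaw, multivariateGaussian, hs]
  simp

instance isProbabilityMeasure_itemLaw (n : ℕ) (c : EuclideanSpace ℝ (Fin n)) (r : ℝ) :
    IsProbabilityMeasure (itemLaw n c r) := by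
  unfold itemLaw; infer_instance

/-- The two items of a random pair, expressed through the independent Gaussian vectors
`p - q` and `p + q`. -/
lemma itemLaw_prod_eq_map (n : ℕ) (c : EuclideanSpace ℝ (Fin n)) {r : ℝ} (hr : 0 ≤ r) :
    (itemLaw n c r).prod (itemLaw n c r) =
      ((stdGaussian (EuclideanSpace ℝ (Fin n))).prod (stdGaussian (EuclideanSpace ℝ (Fin n)))).map
        (fun ab => (c + (r / √n) • (ab.1 + ab.2), c + (r / √n) • (ab.2 - ab.1))) := by
  rw [itemLaw_eq_map_stdGaussian n c hr, Measure.map_prod_map _ _ (by fun_prop) (by fun_prop),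
    ← IsGaussian.map_rotation_eq_self (μ := stdGaussian (EuclideanSpace ℝ (Fin n)))
      (by simp) (Real.pi / 4), Measure.map_map (by fun_prop) (by fun_prop)]
  -- The backward rewrite also introduced the rotation on the right-hand side; it is removed there.
  rw [IsGaussian.map_rotation_eq_self (by simp)]
  congr 1
  ext1 ab
  have h2 : √2 * (r / √n) * (√2 / 2) = r / √n := by
    linear_combination r / √n / 2 * Real.mul_self_sqrt (zero_le_two (α := ℝ))
  simp only [Function.comp_apply, ContinuousLinearMap.rotation_apply, Prod.map_apply,
    Real.cos_pi_div_four, Real.sin_pi_div_four, smul_add, smul_smul, smul_sub, h2,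
    neg_smul, neg_add_eq_sub]

/-- A random pair separates `x` from any fixed point at distance `r / 2` with probability bounded
below, with margin `r / (64 √n)`. -/
lemma le_itemLaw_prod_separatingPairs {n : ℕ} (hn : 1 ≤ n) {c x y : EuclideanSpace ℝ (Fin n)}
    {r : ℝ} (hr : 0 < r) (hx : ‖x - c‖ ≤ r) (hxy : ‖x - y‖ = r / 2) :
    ENNReal.ofReal separationProb ≤
      ((itemLaw n c r).prod (itemLaw n c r)) (separatingPairs x y (r / √n / 64)) := by
  have hnpos : (0 : ℝ) < n := Nat.cast_pos.2 hn
  have hρ : 0 < r / √n := by positivity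
  rw [itemLaw_prod_eq_map n c hr.le, Measure.map_apply (by fun_prop)
    (measurableSet_separatingPairs _ _ _)]
  have hfin : Module.finrank ℝ (EuclideanSpace ℝ (Fin n)) = n := by simp
  have key := stdGaussian_prod_separating (E := EuclideanSpace ℝ (Fin n)) (by rw [hfin]; exact hn)
    (x := r⁻¹ • (x - c)) (y := r⁻¹ • (y - c))
    (by rw [norm_smul, norm_inv, Real.norm_of_nonneg hr.le, inv_mul_le_iff₀ hr]; simpa using hx)
    (by rw [← smul_sub, sub_sub_sub_cancel_right, norm_smul, norm_inv, Real.norm_of_nonneg hr.le,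
          hxy]; field_simp)
  refine key.trans (measure_mono ?_)
  rw [hfin]
  rintro ⟨a, b⟩ hab
  -- Gap and margin share the factor `4 (r / √n) ^ 2`; cancelling it leaves the normalized
  -- inequalities of `key`.
  have hgap (z : EuclideanSpace ℝ (Fin n)) :
      comparisonGap (c + (r / √n) • (a + b), c + (r / √n) • (b - a)) z =
        4 * (r / √n) ^ 2 * (√n * ⟪a, r⁻¹ • (z - c)⟫ - ⟪a, b⟫) := by
    rw [comparisonGap_add_smul, inner_smul_right]
    field_simp
  have hnorm : 2 * (r / √n / 64) * ‖(c + (r / √n) • (a + b)) - (c + (r / √n) • (b - a))‖ =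
      4 * (r / √n) ^ 2 * (‖a‖ / 64) := by
    rw [show (c + (r / √n) • (a + b)) - (c + (r / √n) • (b - a)) = (2 * (r / √n)) • a by module,
      norm_smul, Real.norm_of_nonneg (by positivity)]
    ring
  have h4 : 0 < 4 * (r / √n) ^ 2 := by positivity
  simp only [Set.mem_preimage, separatingPairs, Set.mem_ofPred_eq, hgap, hnorm,
    ← mul_neg (4 * (r / √n) ^ 2), mul_lt_mul_iff_right₀ h4]
  exact hab

/-! ### Nets and the failure probability of one stage -/

/-- A bounded set in `ℝⁿ` has a finite net whose size is that of a cubic grid. -/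
lemma exists_finset_net {n : ℕ} {S : Set (EuclideanSpace ℝ (Fin n))} {x : EuclideanSpace ℝ (Fin n)}
    {K : ℕ} {h : ℝ} (hh : 0 < h) (hS : ∀ y ∈ S, ‖y - x‖ ≤ K * h) :
    ∃ T : Finset (EuclideanSpace ℝ (Fin n)), ↑T ⊆ S ∧ T.card ≤ (2 * K + 1) ^ n ∧
      ∀ y ∈ S, ∃ z ∈ T, ‖y - z‖ ≤ √n * h := by
  have hcoord {y} (hy : y ∈ S) (i : Fin n) : |y i - x i| ≤ K * h := by
    simpa using (PiLp.norm_apply_le (y - x) i).trans (hS y hy)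
  -- The shift by `K` makes grid coordinates nonnegative, with floors below `2 * K + 1`, so
  -- `Fin.ofNat` below does not wrap around.
  set g : EuclideanSpace ℝ (Fin n) → Fin n → ℝ := fun y i => (y i - x i) / h + K with hg
  have hg0 {y} (hy : y ∈ S) (i : Fin n) : 0 ≤ g y i := by
    have := (abs_le.1 (hcoord hy i)).1
    rw [← neg_mul, ← le_div_iff₀ hh] at this
    simp only [hg]; linarith
  have hgK {y} (hy : y ∈ S) (i : Fin n) : ⌊g y i⌋₊ < 2 * K + 1 := by
    have := (abs_le.1 (hcoord hy i)).2
    rw [← div_le_iff₀ hh] at this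
    rw [Nat.floor_lt (hg0 hy i)]
    simp only [hg]; push_cast; linarith
  -- One representative is kept per occupied grid cell, so the net lies in `S` itself.
  obtain ⟨u, huS, hbij⟩ := Set.exists_subset_bijOn S (fun y i => Fin.ofNat (2 * K + 1) ⌊g y i⌋₊)
  have hfin : u.Finite := Set.Finite.of_finite_image (Set.toFinite _) hbij.injOn
  refine ⟨hfin.toFinset, by simpa using huS, ?_, fun y hy => ?_⟩
  · have := Finset.card_le_card_of_injOn (s := hfin.toFinset) (t := Finset.univ) _
      (fun _ _ => Finset.mem_coe.2 (Finset.mem_univ _)) (by simpa using hbij.injOn)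
    simpa using this
  · obtain ⟨z, hzu, hz⟩ := hbij.surjOn ⟨y, hy, rfl⟩
    refine ⟨z, by simpa using hzu, ?_⟩
    have hclose (i : Fin n) : |y i - z i| ≤ h := by
      have h1 := congrArg Fin.val (congrFun hz i)
      simp only [Fin.val_ofNat, Nat.mod_eq_of_lt (hgK hy i),
        Nat.mod_eq_of_lt (hgK (huS hzu) i)] at h1
      have h2 : |g y i - g z i| < 1 := by
        have a1 := Nat.floor_le (hg0 hy i)
        have a2 := Nat.lt_floor_add_one (g y i)
        have a3 := Nat.floor_le (hg0 (huS hzu) i)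
        have a4 := Nat.lt_floor_add_one (g z i)
        rw [h1] at a3 a4
        rw [abs_lt]; constructor <;> linarith
      have h3 : g y i - g z i = (y i - z i) / h := by simp only [hg]; ring
      rw [h3, abs_div, abs_of_pos hh, div_lt_one hh] at h2
      exact h2.le
    rw [EuclideanSpace.norm_eq, Real.sqrt_le_left (by positivity), mul_pow,
      Real.sq_sqrt (by positivity)]
    calc ∑ i, ‖(y - z) i‖ ^ 2 ≤ ∑ _ : Fin n, h ^ 2 := by
          refine Finset.sum_le_sum fun i _ => pow_le_pow_left₀ (norm_nonneg _) ?_ 2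
          simpa using hclose i
      _ = n * h ^ 2 := by simp

/-- One stage: outside a measurable set of items that is unlikely for every centre whose ball
contains `x`, all points consistent with the comparisons are within `r / 2` of `x`. -/
lemma exists_stage_failure_set {n : ℕ} (hn : 1 ≤ n) (k : ℕ) (x : EuclideanSpace ℝ (Fin n)) {r : ℝ}
    (hr : 0 < r) :
    ∃ B : Set (Fin k → EuclideanSpace ℝ (Fin n) × EuclideanSpace ℝ (Fin n)), MeasurableSet B ∧
      (∀ c, ‖x - c‖ ≤ r → stageLaw n k c r B ≤
        ENNReal.ofReal ((65 * n : ℝ) ^ n * (1 - separationProb) ^ k)) ∧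
      ∀ pq ∉ B, ∀ y, comparisons pq y = comparisons pq x → ‖x - y‖ ≤ r / 2 := by
  have hnpos : (0 : ℝ) < n := Nat.cast_pos.2 hn
  -- The grid step makes `K * h = r / 2`, the radius of the sphere, and `√n * h = r / √n / 64`, the
  -- separation margin.
  obtain ⟨T, hTS, hTcard, hTnet⟩ := exists_finset_net (S := {y | ‖x - y‖ = r / 2}) (x := x)
    (K := 32 * n) (h := r / (64 * n)) (by positivity) (fun y hy => by
      rw [norm_sub_rev, Set.mem_ofPred.1 hy]
      push_cast
      apply le_of_eq
      field_simp
      norm_num)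
  have hδ : √n * (r / (64 * n)) = r / √n / 64 := by
    have := Real.mul_self_sqrt hnpos.le
    field_simp
    linarith
  rw [hδ] at hTnet
  set δ := r / √n / 64 with hδdef
  have hδ0 : 0 ≤ δ := by positivity
  have hmeas (z : EuclideanSpace ℝ (Fin n)) :
      MeasurableSet (Set.univ.pi fun _ : Fin k => (separatingPairs x z δ)ᶜ) :=
    .univ_pi fun _ => (measurableSet_separatingPairs x z δ).compl
  refine ⟨⋃ z ∈ T, Set.univ.pi fun _ => (separatingPairs x z δ)ᶜ,
    T.measurableSet_biUnion fun z _ => hmeas z, fun c hc => ?_, fun pq hpq y hy => ?_⟩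
  · have hcompl (z) (hz : z ∈ T) : ((itemLaw n c r).prod (itemLaw n c r))
        (separatingPairs x z δ)ᶜ ≤ ENNReal.ofReal (1 - separationProb) := by
      rw [prob_compl_eq_one_sub (measurableSet_separatingPairs x z δ),
        ENNReal.ofReal_sub _ separationProb_pos.le, ENNReal.ofReal_one]
      exact tsub_le_tsub_left (le_itemLaw_prod_separatingPairs hn hr hc (hTS hz)) _
    calc stageLaw n k c r (⋃ z ∈ T, Set.univ.pi fun _ => (separatingPairs x z δ)ᶜ)
        ≤ ∑ z ∈ T, stageLaw n k c r (Set.univ.pi fun _ => (separatingPairs x z δ)ᶜ) :=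
          measure_biUnion_finset_le _ _
      _ ≤ ∑ _ ∈ T, ENNReal.ofReal (1 - separationProb) ^ k := by
          refine Finset.sum_le_sum fun z hz => ?_
          rw [stageLaw, Measure.pi_pi]
          simpa using pow_le_pow_left₀ zero_le (hcompl z hz) k
      _ = T.card * ENNReal.ofReal (1 - separationProb) ^ k := by
          rw [Finset.sum_const, nsmul_eq_mul]
      _ ≤ ENNReal.ofReal ((65 * n : ℝ) ^ n) * ENNReal.ofReal ((1 - separationProb) ^ k) := by
          rw [← ENNReal.ofReal_pow (sub_nonneg.2 separationProb_le_one), ← ENNReal.ofReal_natCast]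
          gcongr
          calc (T.card : ℝ) ≤ ((2 * (32 * n) + 1) ^ n : ℕ) := by exact_mod_cast hTcard
            _ ≤ (65 * n : ℝ) ^ n := by
              push_cast
              gcongr
              have : (1 : ℝ) ≤ n := by exact_mod_cast hn
              linarith
      _ = _ := (ENNReal.ofReal_mul (by positivity)).symm
  · by_contra! hlt
    have hsign (i : Fin k) : SignType.sign (comparisonGap (pq i) y) =
        SignType.sign (comparisonGap (pq i) x) := congrFun hy i
    have hpos : 0 < ‖x - y‖ := by linarith
    -- Pull `y` back along the segment to the sphere: the point reached is still consistent, yet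
    -- some pair separates `x` from everything within the margin of a nearby net point.
    set s := r / 2 / ‖x - y‖ with hs
    have hs0 : 0 ≤ s := by positivity
    have hs1 : s ≤ 1 := (div_le_one hpos).2 hlt.le
    obtain ⟨z, hzT, hz⟩ := hTnet (x + s • (y - x)) (by
      rw [Set.mem_ofPred, sub_add_cancel_left, norm_neg, norm_smul, Real.norm_of_nonneg hs0,
        norm_sub_rev, hs, div_mul_cancel₀ _ hpos.ne'])
    refine hpq (Set.mem_biUnion hzT fun i _ hi => ?_)
    exact sign_comparisonGap_ne hδ0 hi hz (sign_comparisonGap_add_smul (hsign i) hs0 hs1)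

/-- The number of comparisons that makes the failure probability of a stage at most `η`. -/
lemma stage_failure_prob_le {n k : ℕ} (hn : 1 ≤ n) {η : ℝ} (hη : 0 < η)
    (hk : 8 / separationProb * (n * Real.log (2 * √n) + Real.log (1 / η)) ≤ k) (hη1 : η ≤ 1) :
    (65 * n : ℝ) ^ n * (1 - separationProb) ^ k ≤ η := by
  have hc := separationProb_pos
  have hn1 : (1 : ℝ) ≤ n := by exact_mod_cast hn
  have hlogη : 0 ≤ Real.log (1 / η) := Real.log_nonneg (by rw [le_div_iff₀ hη]; linarith)
  -- The factor `8` comes from `65 n ≤ 256 n ^ 4 = (2√n) ^ 8`.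
  have hbase : (65 * n : ℝ) ≤ Real.exp (8 * Real.log (2 * √n)) := by
    rw [mul_comm 8, Real.exp_mul, Real.exp_log (by positivity)]
    have h : (2 * √(n : ℝ)) ^ (8 : ℝ) = 256 * (n : ℝ) ^ 4 := by
      have := Real.sq_sqrt (zero_le_one.trans hn1)
      norm_cast
      push_cast
      rw [mul_pow, show (√(n : ℝ)) ^ 8 = (√(n : ℝ) ^ 2) ^ 4 by ring, this]
      norm_num
    rw [h]
    have := le_self_pow₀ hn1 (n := 4) (by norm_num)
    linarith
  have hkc : 8 * (n * Real.log (2 * √n) + Real.log (1 / η)) ≤ separationProb * k := by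
    rw [div_mul_eq_mul_div, div_le_iff₀ hc] at hk
    linarith
  calc (65 * n : ℝ) ^ n * (1 - separationProb) ^ k
      ≤ Real.exp (8 * Real.log (2 * √n)) ^ n * Real.exp (-separationProb) ^ k := by
        have h := sub_nonneg.2 separationProb_le_one
        gcongr
        exact Real.one_sub_le_exp_neg _
    _ = Real.exp (n * (8 * Real.log (2 * √n)) - separationProb * k) := by
        rw [← Real.exp_nat_mul, ← Real.exp_nat_mul, ← Real.exp_add]
        congr 1; ring
    _ ≤ Real.exp (-Real.log (1 / η)) := Real.exp_le_exp.2 (by linarith)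
    _ = η := by rw [one_div, Real.log_inv, neg_neg, Real.exp_log hη]

/-! ### Chaining the stages -/

/-- The event that `x` is still in the current ball is known before the stage, so `cond_law` applies
on it, and there the integrand is at most `b` pointwise. -/
lemma AdaptiveScheme.measure_failure_le {n : ℕ} {Ω : Type*} [MeasurableSpace Ω] {μ : Measure Ω}
    [IsProbabilityMeasure μ] {x : EuclideanSpace ℝ (Fin n)} {R : ℝ} {t : ℕ} {N : ℕ → ℕ}
    (S : AdaptiveScheme μ x R t N) {ℓ : ℕ} (hℓ : ℓ < t)
    {B : Set (Fin (N ℓ) → EuclideanSpace ℝ (Fin n) × EuclideanSpace ℝ (Fin n))}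
    (hB : MeasurableSet B) {b : ℝ≥0∞}
    (hb : ∀ c, ‖x - c‖ ≤ stageRadius R ℓ → stageLaw n (N ℓ) c (stageRadius R ℓ) B ≤ b) :
    μ ({ω | ‖x - S.est ℓ ω‖ ≤ stageRadius R ℓ} ∩ S.items ℓ ⁻¹' B) ≤ b := by
  have hA : MeasurableSet[S.hist ℓ] {ω | ‖x - S.est ℓ ω‖ ≤ stageRadius R ℓ} :=
    (S.measurable_est ℓ hℓ.le) (measurableSet_le (f := fun c => ‖x - c‖)
      (g := fun _ => stageRadius R ℓ) (by fun_prop) (by fun_prop))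
  rw [S.cond_law ℓ hℓ _ hA B hB]
  calc _ ≤ ∫⁻ _ in {ω | ‖x - S.est ℓ ω‖ ≤ stageRadius R ℓ}, b ∂μ :=
        setLIntegral_mono' (S.hist.le ℓ _ hA) fun ω hω => hb _ hω
    _ ≤ b := by
        rw [setLIntegral_const]
        exact mul_le_of_le_one_right' prob_le_one

/-- If every stage fails with probability at most `η`, the whole scheme fails with probability at
most `t η`. -/
lemma AdaptiveScheme.exists_success_set {n : ℕ} {Ω : Type*} [MeasurableSpace Ω] {μ : Measure Ω}
    [IsProbabilityMeasure μ] {x : EuclideanSpace ℝ (Fin n)} {R : ℝ} {t : ℕ} {N : ℕ → ℕ}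
    (S : AdaptiveScheme μ x R t N) (ht : 1 ≤ t) (hn : 1 ≤ n) (hR : 0 < R) (hx : ‖x‖ ≤ R) {η : ℝ}
    (hη : 0 ≤ η)
    (hN : ∀ ℓ < t, (65 * n : ℝ) ^ n * (1 - separationProb) ^ N ℓ ≤ η) :
    ∃ G : Set Ω, MeasurableSet G ∧ 1 - t * η ≤ μ.real G ∧
      ∀ ω ∈ G, ∀ y : EuclideanSpace ℝ (Fin n),
        comparisons (S.items (t - 1) ω) y = comparisons (S.items (t - 1) ω) x →
          ‖x - y‖ ≤ R / 2 ^ t := by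
  have hr (ℓ : ℕ) : 0 < stageRadius R ℓ := by unfold stageRadius; positivity
  have hhalf (ℓ : ℕ) : stageRadius R ℓ / 2 = stageRadius R (ℓ + 1) := by
    simp only [stageRadius, pow_succ, div_div]
  choose B hB hBlaw hBcons using fun ℓ => exists_stage_failure_set hn (N ℓ) x (hr ℓ)
  set A : ℕ → Set Ω := fun ℓ => {ω | ‖x - S.est ℓ ω‖ ≤ stageRadius R ℓ} with hA
  have hcons : ∀ᵐ ω ∂μ, ∀ ℓ < t, ω ∈ A ℓ →
      comparisons (S.items ℓ ω) (S.est (ℓ + 1) ω) = comparisons (S.items ℓ ω) x :=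
    ae_all_iff.2 fun ℓ => ae_all_iff.2 fun hℓ => S.consistent ℓ hℓ
  -- The null set where consistency fails need not be measurable, hence its measurable hull.
  set F : Set Ω := toMeasurable μ {ω | ¬ ∀ ℓ < t, ω ∈ A ℓ →
      comparisons (S.items ℓ ω) (S.est (ℓ + 1) ω) = comparisons (S.items ℓ ω) x} ∪
    ⋃ ℓ ∈ Finset.range t, (A ℓ ∩ S.items ℓ ⁻¹' B ℓ) with hF
  have hFmeas : MeasurableSet F := by
    refine (measurableSet_toMeasurable _ _).union (Finset.measurableSet_biUnion _ fun ℓ hℓ => ?_)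
    have hℓ := Finset.mem_range.1 hℓ
    refine .inter ?_ (((S.measurable_items ℓ hℓ).mono (S.hist.le _) le_rfl) (hB ℓ))
    have := (S.measurable_est ℓ hℓ.le).mono (S.hist.le _) le_rfl
    exact measurableSet_le (by fun_prop) (by fun_prop)
  have hμF : μ F ≤ ENNReal.ofReal (t * η) := by
    calc μ F ≤ 0 + ∑ ℓ ∈ Finset.range t, μ (A ℓ ∩ S.items ℓ ⁻¹' B ℓ) := by
          refine (measure_union_le _ _).trans (add_le_add ?_ (measure_biUnion_finset_le _ _))
          rw [measure_toMeasurable]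
          exact (ae_iff.1 hcons).le
      _ ≤ 0 + ∑ _ ∈ Finset.range t, ENNReal.ofReal η := by
          gcongr with ℓ hℓ
          have hℓ := Finset.mem_range.1 hℓ
          exact S.measure_failure_le hℓ (hB ℓ) fun c hc =>
            (hBlaw ℓ c hc).trans (ENNReal.ofReal_le_ofReal (hN ℓ hℓ))
      _ = ENNReal.ofReal (t * η) := by
          rw [zero_add, Finset.sum_const, Finset.card_range, nsmul_eq_mul,
            ENNReal.ofReal_mul (by positivity), ENNReal.ofReal_natCast]
  refine ⟨Fᶜ, hFmeas.compl, ?_, fun ω hω y hy => ?_⟩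
  · rw [probReal_compl_eq_one_sub hFmeas]
    have := ENNReal.toReal_le_of_le_ofReal (by positivity) hμF
    exact sub_le_sub_left this 1
  · rw [hF, Set.compl_union] at hω
    have hω1 := not_not.1 fun h => hω.1 (subset_toMeasurable μ _ h)
    have hω2 (ℓ : ℕ) (hℓ : ℓ < t) (h : ω ∈ A ℓ) : S.items ℓ ω ∉ B ℓ := fun hmem =>
      hω.2 (Set.mem_biUnion (Finset.mem_coe.2 (Finset.mem_range.2 hℓ)) ⟨h, hmem⟩)
    -- Success of a stage puts its estimate within half the radius, which is what the next stage
    -- needs to start.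
    have hmem (ℓ : ℕ) (hℓ : ℓ < t) : ω ∈ A ℓ := by
      induction ℓ with
      | zero => simpa [hA, S.est_zero, stageRadius] using hx
      | succ ℓ ih =>
        have h := ih (by omega)
        have := hBcons ℓ _ (hω2 ℓ (by omega) h) _ (hω1 ℓ (by omega) h)
        rwa [hhalf] at this
    have hlast : t - 1 < t := by omega
    have := hBcons (t - 1) _ (hω2 _ hlast (hmem _ hlast)) y hy
    rwa [hhalf, Nat.sub_add_cancel ht] at this

/-- There is a universal constant `C` such that the adaptive scheme with `t = ⌈log₂ (R / ε)⌉` stages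
and a total budget of `m` comparisons, split so that every stage gets at least `⌊m / t⌋`, localizes
`x` to accuracy `ε`. Consistency of the final estimate `y` is required only with the comparisons of
the last stage, so the conclusion covers every `y` that is consistent with all comparisons made. -/
theorem mainTheorem6 :
    ∃ C : ℝ, 0 < C ∧
      ∀ (n : ℕ) (_hn : 1 ≤ n) (R ε η : ℝ) (_hε : 0 < ε) (_hεR : ε < R) (_hη : 0 < η)
        (x : EuclideanSpace ℝ (Fin n)) (_hx : ‖x‖ ≤ R)
        (t : ℕ) (_ht : t = ⌈Real.logb 2 (R / ε)⌉₊)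
        (m : ℕ)
        (_hm : 2 * C * Real.logb 2 (2 * R / ε) *
            ((n : ℝ) * Real.log (2 * Real.sqrt n) + Real.log (1 / η)) ≤ (m : ℝ))
        (N : ℕ → ℕ) (_hN : ∀ ℓ < t, m / t ≤ N ℓ) (_hNm : ∑ ℓ ∈ Finset.range t, N ℓ ≤ m)
        (Ω : Type*) [MeasurableSpace Ω] (μ : Measure Ω) [IsProbabilityMeasure μ]
        (S : AdaptiveScheme μ x R t N),
        ∃ G : Set Ω, MeasurableSet G ∧
          1 - Real.logb 2 (2 * R / ε) * η ≤ μ.real G ∧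
          ∀ ω ∈ G, ∀ y : EuclideanSpace ℝ (Fin n),
            comparisons (S.items (t - 1) ω) y = comparisons (S.items (t - 1) ω) x →
              ‖x - y‖ ≤ ε := by
  refine ⟨8 / separationProb, div_pos (by norm_num) separationProb_pos, ?_⟩
  intro n hn R ε η hε hεR hη x hx t ht m hm N hN _ Ω _ μ _ S
  have hR : 0 < R := hε.trans hεR
  have hratio : 1 < R / ε := (one_lt_div hε).2 hεR
  have hlog : 0 < Real.logb 2 (R / ε) := Real.logb_pos one_lt_two hratio
  have hL : Real.logb 2 (2 * R / ε) = Real.logb 2 (R / ε) + 1 := by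
    rw [mul_div_assoc, Real.logb_mul two_ne_zero (by positivity), Real.logb_self_eq_one one_lt_two,
      add_comm]
  rw [hL] at hm ⊢
  set L := Real.logb 2 (R / ε)
  -- For `1 ≤ η` the claimed probability bound is nonpositive, and the empty event suffices.
  rcases le_total 1 η with hη1 | hη1
  · exact ⟨∅, .empty, by simp only [measureReal_empty]; nlinarith, by simp⟩
  have ht1 : 1 ≤ t := ht ▸ Nat.ceil_pos.2 hlog
  have ht1' : (1 : ℝ) ≤ t := by exact_mod_cast ht1
  have htL : (t : ℝ) ≤ L + 1 := ht ▸ (Nat.ceil_lt_add_one hlog.le).le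
  have hLt : L ≤ t := ht ▸ Nat.le_ceil _
  have hRt : R / 2 ^ t ≤ ε := by
    rw [Real.logb_le_iff_le_rpow one_lt_two (by positivity), Real.rpow_natCast,
      div_le_iff₀ hε] at hLt
    rw [div_le_iff₀ (by positivity)]
    linarith
  set K : ℝ := n * Real.log (2 * √n) + Real.log (1 / η) with hK
  have hK1 : 1 / 2 ≤ K := by
    have hn1 : (1 : ℝ) ≤ n := by exact_mod_cast hn
    have h1 : 0 ≤ Real.log (1 / η) := Real.log_nonneg ((one_le_div hη).2 hη1)
    have h2 : Real.log 2 ≤ Real.log (2 * √n) :=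
      Real.log_le_log two_pos (by linarith [Real.one_le_sqrt.2 hn1])
    nlinarith [Real.log_two_gt_d9]
  set C : ℝ := 8 / separationProb with hC
  have hC8 : 8 ≤ C := by
    rw [hC, le_div_iff₀ separationProb_pos]
    linarith [separationProb_le_one]
  have hCK : 1 ≤ C * K := by nlinarith
  -- The factor `2` in the budget pays for the floor in `m / t`: since `t ≤ L + 1`, `2 * (C * K) < N
  -- ℓ + 1`, and `1 ≤ C * K` absorbs the `1`.
  have hstage (ℓ : ℕ) (hℓ : ℓ < t) : C * K ≤ N ℓ := by
    have h1 : m < t * (m / t + 1) := Nat.lt_mul_div_succ m ht1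
    have h2 : (m : ℝ) < t * (N ℓ + 1) := by
      calc (m : ℝ) < ((t * (m / t + 1) : ℕ) : ℝ) := by exact_mod_cast h1
        _ ≤ ((t * (N ℓ + 1) : ℕ) : ℝ) := by
          exact_mod_cast Nat.mul_le_mul_left t (Nat.succ_le_succ (hN ℓ hℓ))
        _ = t * (N ℓ + 1) := by push_cast; ring
    have h3 : t * (2 * (C * K)) < t * (N ℓ + 1) := by
      refine lt_of_le_of_lt ?_ (hm.trans_lt h2)
      have := mul_le_mul_of_nonneg_right htL (by linarith : 0 ≤ 2 * (C * K))
      linarith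
    have h4 := lt_of_mul_lt_mul_left h3 (by linarith)
    linarith
  obtain ⟨G, hG, hμG, hGy⟩ := S.exists_success_set ht1 hn hR hx hη.le
    fun ℓ hℓ => stage_failure_prob_le hn hη (hstage ℓ hℓ) hη1
  exact ⟨G, hG, by nlinarith, fun ω hω y hy => (hGy ω hω y hy).trans hRt⟩
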